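/- Let $n$ be a natural number, $[n]=\{1,\dots,n\}$, $\mathbb{R}_{\max}=\mathbb{R}\cup\{-\infty\}$, and let $\mathcal{C}\subset\mathbb{R}_{\max}^n$ be a real polyhedral cone, i.e. the set of all vectors $x$ with $x_i=\max_{r}(\lambda_r+v^r_i)$ for all $i\in[n]$, with $\lambda_1,\dots,\lambda_p\in\mathbb{R}_{\max}$, for some finitely many vectors $v^1,\dots,v^p\in\mathbb{R}^n$. Let $\mathbb{P}^{n-1}=\mathbb{R}^n/\mathbb{R}(1,\dots,1)$, with the topology of the metric $d_H(x,y)=\max_i(x_i-y_i)-\min_i(x_i-y_i)$. Identify $\mathcal{C}$ with its image in $\mathbb{P}^{n-1}$, that is, the set of classes of the vectors of $\mathcal{C}\cap\mathbb{R}^n$, and let $\partial\mathcal{C}$ be the boundary of this image in $\mathbb{P}^{n-1}$. For $a\in\mathbb{P}^{n-1}$ and a non-empty proper subset $I$ of $[n]$, the half-space with apex $a$ and sectors $I$ is $$\mathcal{H}(a,I)=\Bigl\{x\in\mathbb{R}_{\max}^n \;\Big|\; \max_{i\in I}(x_i-a_i)\ge\max_{j\in[n]\setminus I}(x_j-a_j)\Bigr\}.$$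 Let $\Sigma$ be the set of half-spaces that contain $\mathcal{C}$ and whose apex belongs to $\mathcal{C}$. For $\Gamma\subset\Sigma$ let $$\tau(\Gamma)=\Bigl\{\mathcal{H}\in\Sigma \;\Big|\; \bigcap_{\mathcal{H}'\in\Gamma}\mathcal{H}'\subset\mathcal{H}\Bigr\},$$ where the empty intersection is $\mathbb{R}_{\max}^n$. For $a\in\partial\mathcal{C}$ let $\Sigma_a$ be the set of half-spaces with apex $a$ that contain $\mathcal{C}$, and for $X\subset\partial\mathcal{C}$ let $$\tau'(X)=\Bigl\{a\in\partial\mathcal{C} \;\Big|\; \Sigma_a\subset\tau\Bigl(\bigcup_{b\in X}\Sigma_b\Bigr)\Bigr\}.$$ A non-redundant external representation of $\mathcal{C}$ is a finite set $\Gamma\subset\Sigma$ such that $\mathcal{C}=\bigcap_{\mathcal{H}\in\Gamma}\mathcal{H}$ and $\mathcal{H}\notin\tau(\Gamma\setminus\{\mathcal{H}\})$ for every $\mathcal{H}\in\Gamma$. Then the following hold. 1. $\tau'$ is a closure operator on $\partial\mathcal{C}$: for all $X\subset Y\subset\partial\mathcal{C}$ we have $\tau'(X)\subset\partial\mathcal{C}$,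 $\tau'(\emptyset)=\emptyset$, $X\subset\tau'(X)$, $\tau'(X)\subset\tau'(Y)$ and $\tau'(\tau'(X))=\tau'(X)$. 2. Among the finite subsets $X$ of $\partial\mathcal{C}$ with $\tau'(X)=\partial\mathcal{C}$ there is exactly one, $\mathcal{A}$, that is minimal for inclusion. 3. For every non-redundant external representation $\Gamma$ of $\mathcal{C}$, the set of apices of the half-spaces in $\Gamma$ is equal to $\mathcal{A}$. -/

import Mathlib

namespace TropicalCone

/-- The max-plus semiring `ℝ ∪ {-∞}`: tropical addition is `⊔`, tropical multiplication is `+`. -/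
abbrev MaxPlus : Type := WithBot ℝ

section RealProjectiveSpace

/-- Two real vectors are identified when they differ by a tropical scalar multiple. -/
def projSetoid (n : ℕ) : Setoid (Fin n → ℝ) where
  r x y := ∃ c : ℝ, ∀ i, y i = c + x i
  iseqv :=
    { refl := fun _ => ⟨0, fun _ => by simp⟩
      symm := fun ⟨c, h⟩ => ⟨-c, fun i => by rw [h i]; ring⟩
      trans := fun ⟨c, h⟩ ⟨d, k⟩ => ⟨d + c, fun i => by rw [k i, h i]; ring⟩ }

/-- The real projective space `ℝⁿ / (1, …, 1)ℝ`. -/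
def RealProj (n : ℕ) : Type := Quotient (projSetoid n)

/-- The class of a real vector in the real projective space. -/
def RealProj.mk {n : ℕ} (x : Fin n → ℝ) : RealProj n := Quotient.mk (projSetoid n) x

theorem RealProj.mk_eq_mk {n : ℕ} {x y : Fin n → ℝ} :
    RealProj.mk x = RealProj.mk y ↔ ∃ c : ℝ, ∀ i, y i = c + x i :=
  ⟨fun h => Quotient.exact h, fun h => Quotient.sound h⟩

theorem RealProj.exists_rep {n : ℕ} (a : RealProj n) : ∃ x, RealProj.mk x = a :=
  Quotient.exists_rep a

/-- The tropical Hilbert distance of two real vectors,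
`max_i (x_i - y_i) - min_i (x_i - y_i)`. -/
noncomputable def hilbertDist {n : ℕ} (x y : Fin n → ℝ) : ℝ :=
  (⨆ i, (x i - y i)) - ⨅ i, (x i - y i)

theorem hilbertDist_le_iff {n : ℕ} [Nonempty (Fin n)] {x y : Fin n → ℝ} {d : ℝ} :
    hilbertDist x y ≤ d ↔ ∀ i j, (x i - y i) - (x j - y j) ≤ d := by
  have hf : (Set.range fun i => x i - y i).Finite := Set.finite_range _
  constructor
  · intro h i j
    have h1 := le_ciSup hf.bddAbove i
    have h2 := ciInf_le hf.bddBelow j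
    unfold hilbertDist at h
    beta_reduce at h1 h2
    linarith
  · intro h
    have h1 : (⨆ i, (x i - y i)) ≤ d + ⨅ i, (x i - y i) := by
      refine ciSup_le fun i => ?_
      have h2 : (x i - y i) - d ≤ ⨅ j, (x j - y j) :=
        le_ciInf fun j => by linarith [h i j]
      linarith
    unfold hilbertDist
    linarith

theorem sub_sub_le_hilbertDist {n : ℕ} (x y : Fin n → ℝ) (i j : Fin n) :
    (x i - y i) - (x j - y j) ≤ hilbertDist x y := by
  have : Nonempty (Fin n) := ⟨i⟩
  exact hilbertDist_le_iff.1 le_rfl i j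

theorem hilbertDist_of_isEmpty {n : ℕ} [IsEmpty (Fin n)] (x y : Fin n → ℝ) :
    hilbertDist x y = 0 := by
  simp [hilbertDist, Real.iSup_of_isEmpty, Real.iInf_of_isEmpty]

theorem hilbertDist_le_of_equiv {n : ℕ} {x y x' y' : Fin n → ℝ} (c d : ℝ)
    (hx : ∀ i, x' i = c + x i) (hy : ∀ i, y' i = d + y i) :
    hilbertDist x y ≤ hilbertDist x' y' := by
  rcases isEmpty_or_nonempty (Fin n) with h | h
  · rw [hilbertDist_of_isEmpty, hilbertDist_of_isEmpty]
  · refine hilbertDist_le_iff.2 fun i j => ?_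
    have := sub_sub_le_hilbertDist x' y' i j
    rw [hx, hx, hy, hy] at this
    linarith

/-- The tropical projective Hilbert metric on the real projective space. -/
noncomputable def RealProj.hDist {n : ℕ} (a b : RealProj n) : ℝ :=
  Quotient.liftOn₂ a b hilbertDist (by
    rintro x y x' y' ⟨c, hc⟩ ⟨d, hd⟩
    refine le_antisymm (hilbertDist_le_of_equiv c d hc hd)
      (hilbertDist_le_of_equiv (-c) (-d) (fun i => ?_) (fun i => ?_))
    · rw [hc i]; ring
    · rw [hd i]; ring)

/-- The real projective space carries the tropical projective Hilbert metric, and hence the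
topology that it induces. -/
noncomputable instance instMetricSpaceRealProj (n : ℕ) : MetricSpace (RealProj n) where
  dist := RealProj.hDist
  dist_self a := by
    obtain ⟨x, rfl⟩ := a.exists_rep
    change hilbertDist x x = 0
    simp [hilbertDist]
  dist_comm a b := by
    have key : ∀ x y : Fin n → ℝ, hilbertDist x y ≤ hilbertDist y x := fun x y => by
      rcases isEmpty_or_nonempty (Fin n) with h | h
      · rw [hilbertDist_of_isEmpty, hilbertDist_of_isEmpty]
      · exact hilbertDist_le_iff.2 fun i j => by linarith [sub_sub_le_hilbertDist y x j i]
    obtain ⟨x, rfl⟩ := a.exists_rep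
    obtain ⟨y, rfl⟩ := b.exists_rep
    exact le_antisymm (key x y) (key y x)
  dist_triangle a b c := by
    obtain ⟨x, rfl⟩ := a.exists_rep
    obtain ⟨y, rfl⟩ := b.exists_rep
    obtain ⟨z, rfl⟩ := c.exists_rep
    change hilbertDist x z ≤ hilbertDist x y + hilbertDist y z
    rcases isEmpty_or_nonempty (Fin n) with h | h
    · simp [hilbertDist_of_isEmpty]
    · exact hilbertDist_le_iff.2 fun i j => by
        linarith [sub_sub_le_hilbertDist x y i j, sub_sub_le_hilbertDist y z i j]
  eq_of_dist_eq_zero := by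
    intro a b
    obtain ⟨x, rfl⟩ := a.exists_rep
    obtain ⟨y, rfl⟩ := b.exists_rep
    intro h
    replace h : hilbertDist x y = 0 := h
    rw [RealProj.mk_eq_mk]
    rcases isEmpty_or_nonempty (Fin n) with hn | hn
    · exact ⟨0, fun i => hn.elim i⟩
    · obtain ⟨k⟩ := hn
      refine ⟨y k - x k, fun i => ?_⟩
      linarith [sub_sub_le_hilbertDist x y i k, sub_sub_le_hilbertDist x y k i]

theorem RealProj.dist_mk {n : ℕ} (x y : Fin n → ℝ) :
    dist (RealProj.mk x) (RealProj.mk y) = (⨆ i, (x i - y i)) - ⨅ i, (x i - y i) := rfl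

end RealProjectiveSpace

section Cones

/-- The tropical cone generated by the real vectors `v 1, …, v p`, with coefficients in
`ℝ ∪ {-∞}`. -/
def generatedCone {n p : ℕ} (v : Fin p → Fin n → ℝ) : Set (Fin n → MaxPlus) :=
  {x | ∃ l : Fin p → MaxPlus, ∀ i, x i = Finset.univ.sup fun r => l r + (v r i : MaxPlus)}

/-- Real polyhedral cones: tropical cones generated by finitely many real vectors. -/
def IsRealPolyhedralCone {n : ℕ} (C : Set (Fin n → MaxPlus)) : Prop :=
  ∃ (p : ℕ) (v : Fin p → Fin n → ℝ), C = generatedCone v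

/-- The image of (the real points of) a cone in the real projective space. -/
def projImage {n : ℕ} (C : Set (Fin n → MaxPlus)) : Set (RealProj n) :=
  {a | ∃ x : Fin n → ℝ, (fun i => (x i : MaxPlus)) ∈ C ∧ RealProj.mk x = a}

/-- The boundary `∂C`, taken in the real projective space. -/
def boundary {n : ℕ} (C : Set (Fin n → MaxPlus)) : Set (RealProj n) :=
  frontier (projImage C)

end Cones

section HalfSpaces

/-- `max_{i ∈ I} (x_i - a_i)`, with value `-∞` when `I` is empty. -/
noncomputable def maxDiff {n : ℕ} (a : Fin n → ℝ) (I : Finset (Fin n)) (x : Fin n → MaxPlus) :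
    MaxPlus :=
  I.sup fun i => x i + ((-a i : ℝ) : MaxPlus)

theorem maxDiff_shift {n : ℕ} {a b : Fin n → ℝ} (c : ℝ) (h : ∀ i, b i = c + a i)
    (I : Finset (Fin n)) (x : Fin n → MaxPlus) :
    maxDiff b I x = maxDiff a I x + ((-c : ℝ) : MaxPlus) := by
  unfold maxDiff
  rw [Finset.apply_sup_eq_sup_comp (fun t : MaxPlus => t + ((-c : ℝ) : MaxPlus))
    (fun s t => (max_add_add_right s t _).symm) (WithBot.bot_add _)]
  refine Finset.sup_congr rfl fun i _ => ?_
  simp only [Function.comp, add_assoc, ← WithBot.coe_add]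
  rw [h i]
  congr 2
  ring

/-- The set `{x | max_{i ∈ I} (x_i - a_i) ≥ max_{j ∉ I} (x_j - a_j)}`. -/
def halfSpaceSet {n : ℕ} (a : Fin n → ℝ) (I : Finset (Fin n)) : Set (Fin n → MaxPlus) :=
  {x | maxDiff a Iᶜ x ≤ maxDiff a I x}

/-- The same set for `a` in the real projective space. -/
def projHalfSpaceSet {n : ℕ} (a : RealProj n) (I : Finset (Fin n)) : Set (Fin n → MaxPlus) :=
  Quotient.liftOn a (fun b => halfSpaceSet b I) (by
    rintro b b' ⟨c, hc⟩
    ext x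
    change maxDiff b Iᶜ x ≤ maxDiff b I x ↔ maxDiff b' Iᶜ x ≤ maxDiff b' I x
    rw [maxDiff_shift c hc, maxDiff_shift c hc]
    exact (WithBot.add_le_add_iff_right WithBot.coe_ne_bot).symm)

theorem projHalfSpaceSet_mk {n : ℕ} (a : Fin n → ℝ) (I : Finset (Fin n)) :
    projHalfSpaceSet (RealProj.mk a) I = halfSpaceSet a I := rfl

/-- A (non-degenerate) tropical half-space `H(a, I)`, given by its apex `a` in the real projective
space and its non-empty proper set `I` of sectors. It is identified with a set of max-plus vectors
by the instance below; the set determines the apex and the sectors. -/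
@[ext]
structure HalfSpace (n : ℕ) where
  apex : RealProj n
  sect : Finset (Fin n)
  sect_nonempty : sect.Nonempty
  compl_nonempty : sectᶜ.Nonempty

theorem mem_halfSpaceSet {n : ℕ} {a : Fin n → ℝ} {I : Finset (Fin n)} (hI : I.Nonempty)
    {x : Fin n → MaxPlus} :
    x ∈ halfSpaceSet a I ↔ ∀ j ∉ I, ∃ i ∈ I,
      x j + ((-a j : ℝ) : MaxPlus) ≤ x i + ((-a i : ℝ) : MaxPlus) := by
  change maxDiff a Iᶜ x ≤ maxDiff a I x ↔ _
  unfold maxDiff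
  rw [Finset.sup_le_iff]
  refine forall_congr' fun j => ?_
  rw [Finset.mem_compl]
  refine imp_congr_right fun _ => ?_
  constructor
  · intro h
    obtain ⟨i, hi, he⟩ := Finset.exists_mem_eq_sup I hI
      (fun i => x i + ((-a i : ℝ) : MaxPlus))
    exact ⟨i, hi, he ▸ h⟩
  · rintro ⟨i, hi, h⟩
    exact h.trans (Finset.le_sup (f := fun i => x i + ((-a i : ℝ) : MaxPlus)) hi)

theorem single_mem_halfSpaceSet {n : ℕ} {a : Fin n → ℝ} {I : Finset (Fin n)} (hI : I.Nonempty)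
    (k : Fin n) :
    Function.update (⊥ : Fin n → MaxPlus) k (0 : ℝ) ∈ halfSpaceSet a I ↔ k ∈ I := by
  rw [mem_halfSpaceSet hI]
  constructor
  · intro h
    by_contra hk
    obtain ⟨i, hi, h'⟩ := h k hk
    have hik : i ≠ k := fun e => hk (e ▸ hi)
    rw [Function.update_self, Function.update_of_ne hik, Pi.bot_apply, WithBot.bot_add,
      ← WithBot.coe_add] at h'
    exact absurd h' (by simp)
  · intro hk j hj
    have hjk : j ≠ k := fun e => hj (e ▸ hk)
    exact ⟨k, hk, by rw [Function.update_of_ne hjk, Pi.bot_apply, WithBot.bot_add]; exact bot_le⟩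

theorem pair_mem_halfSpaceSet {n : ℕ} {a : Fin n → ℝ} {I : Finset (Fin n)} {i j : Fin n}
    (hi : i ∈ I) (hj : j ∉ I) (s t : ℝ) :
    Function.update (Function.update (⊥ : Fin n → MaxPlus) i s) j t ∈ halfSpaceSet a I ↔
      t - a j ≤ s - a i := by
  have hij : i ≠ j := fun e => hj (e ▸ hi)
  rw [mem_halfSpaceSet ⟨i, hi⟩]
  constructor
  · intro h
    obtain ⟨k, hk, h'⟩ := h j hj
    have hkj : k ≠ j := fun e => hj (e ▸ hk)
    rw [Function.update_self, Function.update_of_ne hkj, ← WithBot.coe_add] at h'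
    by_cases hki : k = i
    · subst hki
      rw [Function.update_self, ← WithBot.coe_add, WithBot.coe_le_coe] at h'
      linarith
    · rw [Function.update_of_ne hki, Pi.bot_apply, WithBot.bot_add] at h'
      exact absurd h' (by simp)
  · intro h l hl
    refine ⟨i, hi, ?_⟩
    have hli : l ≠ i := fun e => hl (e ▸ hi)
    rw [Function.update_of_ne hij, Function.update_self, ← WithBot.coe_add]
    by_cases hlj : l = j
    · subst hlj
      rw [Function.update_self, ← WithBot.coe_add, WithBot.coe_le_coe]
      linarith
    · rw [Function.update_of_ne hlj, Function.update_of_ne hli, Pi.bot_apply, WithBot.bot_add]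
      exact bot_le

theorem HalfSpace.projHalfSpaceSet_injective {n : ℕ} :
    Function.Injective fun H : HalfSpace n => projHalfSpaceSet H.apex H.sect := by
  rintro ⟨a, I, hI, hIc⟩ ⟨b, J, hJ, hJc⟩ h
  obtain ⟨a, rfl⟩ := a.exists_rep
  obtain ⟨b, rfl⟩ := b.exists_rep
  replace h : halfSpaceSet a I = halfSpaceSet b J := h
  have hIJ : I = J := by
    ext k
    rw [← single_mem_halfSpaceSet (a := a) hI, h, single_mem_halfSpaceSet hJ]
  subst hIJ
  have key : ∀ i ∈ I, ∀ j ∉ I, a i - a j = b i - b j := by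
    intro i hi j hj
    have h1 := (pair_mem_halfSpaceSet (a := a) hi hj (a i) (a j)).2 (by simp)
    rw [h, pair_mem_halfSpaceSet hi hj] at h1
    have h2 := (pair_mem_halfSpaceSet (a := b) hi hj (b i) (b j)).2 (by simp)
    rw [← h, pair_mem_halfSpaceSet hi hj] at h2
    linarith
  obtain ⟨i, hi⟩ := hI
  obtain ⟨j, hj⟩ := hIc
  rw [Finset.mem_compl] at hj
  have hab : RealProj.mk a = RealProj.mk b := by
    rw [RealProj.mk_eq_mk]
    refine ⟨b i - a i, fun k => ?_⟩
    by_cases hk : k ∈ I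
    · linarith [key k hk j hj, key i hi j hj]
    · linarith [key i hi k hk]
  simp [hab]

instance (n : ℕ) : SetLike (HalfSpace n) (Fin n → MaxPlus) where
  coe H := projHalfSpaceSet H.apex H.sect
  coe_injective := HalfSpace.projHalfSpaceSet_injective

end HalfSpaces

section Representations

variable {n : ℕ}

/-- `Σ`: the half-spaces that contain `C` and have their apex in `C`. -/
def supp (C : Set (Fin n → MaxPlus)) : Set (HalfSpace n) :=
  {H | C ⊆ (H : Set (Fin n → MaxPlus)) ∧ H.apex ∈ projImage C}

/-- `τ(Γ)`: the half-spaces in `Σ` that contain the intersection of those in `Γ`. -/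
def tau (C : Set (Fin n → MaxPlus)) (Γ : Set (HalfSpace n)) : Set (HalfSpace n) :=
  {H | H ∈ supp C ∧ (⋂ H' ∈ Γ, (H' : Set (Fin n → MaxPlus))) ⊆ (H : Set (Fin n → MaxPlus))}

/-- `Σ_a`: the half-spaces with apex `a` that contain `C`. -/
def suppAt (C : Set (Fin n → MaxPlus)) (a : RealProj n) : Set (HalfSpace n) :=
  {H | H.apex = a ∧ C ⊆ (H : Set (Fin n → MaxPlus))}

/-- `τ'(X) = {a ∈ ∂C | Σ_a ⊆ τ(⋃_{b ∈ X} Σ_b)}`. -/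
def tau' (C : Set (Fin n → MaxPlus)) (X : Set (RealProj n)) : Set (RealProj n) :=
  {a | a ∈ boundary C ∧ suppAt C a ⊆ tau C (⋃ b ∈ X, suppAt C b)}

/-- `c` is a closure operator on the ground set `G`, with the empty set closed. -/
structure IsClosureOperatorOn {α : Type*} (G : Set α) (c : Set α → Set α) : Prop where
  subset_ground : ∀ X ⊆ G, c X ⊆ G
  empty : c ∅ = ∅
  extensive : ∀ X ⊆ G, X ⊆ c X
  monotone : ∀ X ⊆ G, ∀ Y ⊆ G, X ⊆ Y → c X ⊆ c Y
  idempotent : ∀ X ⊆ G, c (c X) = c X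

/-- The finite spanning sets of `∂C` for the operator `τ'`. -/
def IsFiniteSpanning (C : Set (Fin n → MaxPlus)) (X : Set (RealProj n)) : Prop :=
  X ⊆ boundary C ∧ X.Finite ∧ tau' C X = boundary C

/-- Non-redundant external representations of `C` by finitely many half-spaces with apices
in `C`. -/
structure IsNonRedundantRep (C : Set (Fin n → MaxPlus)) (Γ : Set (HalfSpace n)) : Prop where
  finite : Γ.Finite
  subset : Γ ⊆ supp C
  inter_eq : C = ⋂ H ∈ Γ, (H : Set (Fin n → MaxPlus))
  nonredundant : ∀ H ∈ Γ, H ∉ tau C (Γ \ {H})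

end Representations

end TropicalCone

/-! The core is a partial anti-exchange property, `inter_subset_of_ne_apex`. Suppose an intersection
of half-spaces containing the cone can be cut down to `D` by half-spaces with apex `a`, and also by
half-spaces with another apex `b`. Then it already lies in `D`. A point `x` outside `D` would
satisfy `max (x - a) + max (a - b) ≤ max (x - b)` and the same inequality with `a` and `b` exchanged
(`max_level_add_le`). Together these force `a - b` to be constant, so `a = b` projectively.

Here `D` is the hull `inter (supp C)`, and spanning means cutting out this hull
(`isFiniteSpanning_iff`). By induction over a finite set of other apices, `inter_subset_of_notMem`
shows that an apex is dispensable as soon as some finite spanning set avoids it. Hence a minimal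
spanning set lies in every finite spanning set, which gives uniqueness, and the same lemma controls
the apices of non-redundant representations.

Existence needs one finite spanning set. A point outside the cone is separated from it by a
half-space whose apex is its projection onto the cone. That apex can be moved to a vertex of the
cell complex of the generators, and there are only finitely many vertices. -/

namespace TropicalCone

/-! ### Half-spaces described by level sets -/

section HalfSpaceMembership

variable {n : ℕ}

/-- A vector lies in `H(a, I)` when every level reached by `x - a` is reached on `I`. -/
theorem mem_halfSpaceSet_iff_level {a : Fin n → ℝ} {I : Finset (Fin n)} (hI : I.Nonempty)
    {x : Fin n → MaxPlus} :
    x ∈ halfSpaceSet a I ↔ ∀ (t : ℝ) (j : Fin n), ((t + a j : ℝ) : MaxPlus) ≤ x j →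
      ∃ i ∈ I, ((t + a i : ℝ) : MaxPlus) ≤ x i := by
  rw [mem_halfSpaceSet hI]
  constructor
  · intro h t j hj
    by_cases hjI : j ∈ I
    · exact ⟨j, hjI, hj⟩
    obtain ⟨i, hi, hle⟩ := h j hjI
    refine ⟨i, hi, ?_⟩
    induction hxj : x j using WithBot.recBotCoe with
    | bot => rw [hxj] at hj; simp at hj
    | coe u =>
      rw [hxj] at hj hle
      induction hxi : x i using WithBot.recBotCoe with
      | bot =>
        rw [hxi, ← WithBot.coe_add, WithBot.bot_add] at hle
        exact absurd hle (by simp)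
      | coe w =>
        rw [hxi, ← WithBot.coe_add, ← WithBot.coe_add, WithBot.coe_le_coe] at hle
        rw [WithBot.coe_le_coe] at hj ⊢
        linarith
  · intro h j _
    induction hxj : x j using WithBot.recBotCoe with
    | bot =>
      obtain ⟨i, hi⟩ := hI
      exact ⟨i, hi, by simp⟩
    | coe u =>
      obtain ⟨i, hi, hle⟩ := h (u - a j) j (by rw [hxj]; simp)
      refine ⟨i, hi, ?_⟩
      induction hxi : x i using WithBot.recBotCoe with
      | bot => rw [hxi] at hle; simp at hle
      | coe w =>
        rw [hxi, WithBot.coe_le_coe] at hle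
        rw [← WithBot.coe_add, ← WithBot.coe_add, WithBot.coe_le_coe]
        linarith

theorem coe_mem_halfSpaceSet_iff_level {a y : Fin n → ℝ} {I : Finset (Fin n)} (hI : I.Nonempty) :
    (fun i => (y i : MaxPlus)) ∈ halfSpaceSet a I ↔
      ∀ (t : ℝ) (j : Fin n), t + a j ≤ y j → ∃ i ∈ I, t + a i ≤ y i := by
  simp only [mem_halfSpaceSet_iff_level hI, WithBot.coe_le_coe]

theorem sup_coe_mem_halfSpaceSet {a y : Fin n → ℝ} {I : Finset (Fin n)} (hI : I.Nonempty)
    {x : Fin n → MaxPlus} (hx : x ∈ halfSpaceSet a I)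
    (hy : (fun i => (y i : MaxPlus)) ∈ halfSpaceSet a I) (c : ℝ) :
    (fun i => x i ⊔ ((c + y i : ℝ) : MaxPlus)) ∈ halfSpaceSet a I := by
  rw [mem_halfSpaceSet_iff_level hI] at hx ⊢
  rw [coe_mem_halfSpaceSet_iff_level hI] at hy
  intro t j hj
  rcases le_sup_iff.1 hj with h | h
  · obtain ⟨i, hi, h⟩ := hx t j h
    exact ⟨i, hi, le_sup_of_le_left h⟩
  · rw [WithBot.coe_le_coe] at h
    obtain ⟨i, hi, h⟩ := hy (t - c) j (by linarith)
    exact ⟨i, hi, le_sup_of_le_right (WithBot.coe_le_coe.2 (by linarith))⟩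

theorem HalfSpace.mem_iff {H : HalfSpace n} {a : Fin n → ℝ} (h : RealProj.mk a = H.apex)
    {x : Fin n → MaxPlus} : x ∈ (H : Set (Fin n → MaxPlus)) ↔ x ∈ halfSpaceSet a H.sect := by
  change x ∈ projHalfSpaceSet H.apex H.sect ↔ _
  rw [← h, projHalfSpaceSet_mk]

/-- The intersection of a family of half-spaces. -/
def inter (Γ : Set (HalfSpace n)) : Set (Fin n → MaxPlus) :=
  ⋂ H ∈ Γ, (H : Set (Fin n → MaxPlus))

theorem mem_inter {Γ : Set (HalfSpace n)} {x : Fin n → MaxPlus} :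
    x ∈ inter Γ ↔ ∀ H ∈ Γ, x ∈ (H : Set (Fin n → MaxPlus)) := by
  simp [inter]

theorem inter_union (Γ Δ : Set (HalfSpace n)) : inter (Γ ∪ Δ) = inter Γ ∩ inter Δ :=
  Set.biInter_union Γ Δ _

theorem inter_anti {Γ Δ : Set (HalfSpace n)} (h : Γ ⊆ Δ) : inter Δ ⊆ inter Γ :=
  Set.biInter_subset_biInter_left h

theorem inter_subset {Γ : Set (HalfSpace n)} {H : HalfSpace n} (h : H ∈ Γ) :
    inter Γ ⊆ (H : Set (Fin n → MaxPlus)) :=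
  Set.biInter_subset_of_mem h

theorem sup_coe_mem_inter {Γ : Set (HalfSpace n)} {x : Fin n → MaxPlus} {y : Fin n → ℝ}
    (hx : x ∈ inter Γ) (hy : (fun i => (y i : MaxPlus)) ∈ inter Γ) (c : ℝ) :
    (fun i => x i ⊔ ((c + y i : ℝ) : MaxPlus)) ∈ inter Γ := by
  rw [mem_inter] at *
  intro H hH
  obtain ⟨a, ha⟩ := H.apex.exists_rep
  have hx' := hx H hH
  have hy' := hy H hH
  rw [HalfSpace.mem_iff ha] at hx' hy' ⊢
  exact sup_coe_mem_halfSpaceSet H.sect_nonempty hx' hy' c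

/-- The maximum of `x - a` is attained and real when `x` is not `-∞`. -/
theorem exists_max_level {x : Fin n → MaxPlus} (hx : ∃ j, x j ≠ ⊥) (a : Fin n → ℝ) :
    ∃ s : ℝ, (∃ i, x i = ((s + a i : ℝ) : MaxPlus)) ∧ ∀ i, x i ≤ ((s + a i : ℝ) : MaxPlus) := by
  obtain ⟨j, hj⟩ := hx
  have : Nonempty (Fin n) := ⟨j⟩
  obtain ⟨i, hi⟩ := Finite.exists_max fun i => x i + ((-a i : ℝ) : MaxPlus)
  induction hxi : x i using WithBot.recBotCoe with
  | bot =>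
    have := hi j
    rw [hxi, WithBot.bot_add, le_bot_iff, WithBot.add_eq_bot] at this
    simp [hj] at this
  | coe w =>
    refine ⟨w - a i, ⟨i, by rw [hxi]; simp⟩, fun k => ?_⟩
    have := hi k
    rw [hxi, ← WithBot.coe_add] at this
    induction hxk : x k using WithBot.recBotCoe with
    | bot => simp
    | coe u =>
      rw [hxk, ← WithBot.coe_add, WithBot.coe_le_coe] at this
      rw [WithBot.coe_le_coe]
      linarith

end HalfSpaceMembership

/-! ### Partial anti-exchange -/

section AntiExchange

variable {n : ℕ}

/-- If `x ∈ ⋂ Γ` is cut off from `D` by half-spaces with apex `a`, and `D` is cut out of `⋂ Γ` by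
half-spaces with apex `b`, then `max (x - a) + max (a - b) ≤ max (x - b)`. -/
theorem max_level_add_le {Γ F' : Set (HalfSpace n)} {D : Set (Fin n → MaxPlus)}
    {a b : Fin n → ℝ} {H : HalfSpace n} (hHa : RealProj.mk a = H.apex)
    (hF' : ∀ H' ∈ F', RealProj.mk b = H'.apex) (haΓ : (fun i => (a i : MaxPlus)) ∈ inter Γ)
    (haF' : (fun i => (a i : MaxPlus)) ∈ inter F') (hDH : D ⊆ (H : Set (Fin n → MaxPlus)))
    (hD : inter Γ ∩ inter F' ⊆ D) {x : Fin n → MaxPlus} (hx : x ∈ inter Γ)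
    (hxH : x ∉ (H : Set (Fin n → MaxPlus))) {s u : ℝ}
    (hs : ∃ i, x i = ((s + a i : ℝ) : MaxPlus)) (hs' : ∀ i, x i ≤ ((s + a i : ℝ) : MaxPlus))
    (hu : ∀ i, x i ≤ ((u + b i : ℝ) : MaxPlus)) (k : Fin n) : s + (a k - b k) ≤ u := by
  have : Nonempty (Fin n) := ⟨k⟩
  obtain ⟨m, hm⟩ := Finite.exists_max fun i => a i - b i
  refine le_trans (by linarith [hm k]) (?_ : s + (a m - b m) ≤ u)
  by_contra! hlt
  -- Midpoint of the interval from `u - (a m - b m)` to `s`. With this `c`, the point `x ⊔ (c + a)`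
  -- is governed by `a` when seen from `b`, but still by `x` when seen from `a`.
  set c : ℝ := (s + u - (a m - b m)) / 2 with hc
  have hcs : c < s := by rw [hc]; linarith
  have hcu : u < c + (a m - b m) := by rw [hc]; linarith
  have hzD : (fun i => x i ⊔ ((c + a i : ℝ) : MaxPlus)) ∈ D := by
    refine hD ⟨sup_coe_mem_inter hx haΓ c, mem_inter.2 fun H' hH' => ?_⟩
    have ha' := mem_inter.1 haF' H' hH'
    rw [HalfSpace.mem_iff (hF' H' hH'), coe_mem_halfSpaceSet_iff_level H'.sect_nonempty] at ha'
    rw [HalfSpace.mem_iff (hF' H' hH'), mem_halfSpaceSet_iff_level H'.sect_nonempty]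
    -- `a - b` attains its maximum on the sectors of `H'`. Since `u < c + (a m - b m)`, the maximum
    -- of the new point minus `b` comes from `c + a`, so it is attained there too.
    obtain ⟨i, hi, hmi⟩ := ha' (a m - b m) m (by linarith)
    intro t j hj
    refine ⟨i, hi, le_sup_of_le_right (WithBot.coe_le_coe.2 ?_)⟩
    rcases le_sup_iff.1 hj with h | h
    · have := WithBot.coe_le_coe.1 (h.trans (hu j))
      linarith
    · have := WithBot.coe_le_coe.1 h
      linarith [hm j]
  have hzH := hDH hzD
  rw [HalfSpace.mem_iff hHa, mem_halfSpaceSet_iff_level H.sect_nonempty] at hzH hxH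
  obtain ⟨i₀, hi₀⟩ := hs
  -- As `c < s`, the term `c + a` cannot reach level `s`. So `x` itself reaches its top level on the
  -- sectors of `H`, which puts `x` in `H`.
  obtain ⟨i, hi, hle⟩ := hzH s i₀ (le_sup_of_le_left hi₀.ge)
  refine hxH fun t j hj => ⟨i, hi, ?_⟩
  have hts : t ≤ s := by linarith [WithBot.coe_le_coe.1 (hj.trans (hs' j))]
  rcases le_sup_iff.1 hle with h | h
  · exact le_trans (WithBot.coe_le_coe.2 (by linarith)) h
  · exact absurd (WithBot.coe_le_coe.1 h) (by linarith)

theorem exists_ne_bot_of_notMem {H : HalfSpace n} {x : Fin n → MaxPlus}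
    (hx : x ∉ (H : Set (Fin n → MaxPlus))) : ∃ j, x j ≠ ⊥ := by
  obtain ⟨a, ha⟩ := H.apex.exists_rep
  contrapose! hx
  rw [HalfSpace.mem_iff ha, mem_halfSpaceSet_iff_level H.sect_nonempty]
  intro t j hj
  rw [hx j] at hj
  simp at hj

/-- The partial anti-exchange property of half-spaces. -/
theorem inter_subset_of_ne_apex {C D : Set (Fin n → MaxPlus)} {Γ F F' : Set (HalfSpace n)}
    {a b : RealProj n} (hab : a ≠ b) (ha : a ∈ projImage C) (hb : b ∈ projImage C)
    (hF : ∀ H ∈ F, H.apex = a) (hF' : ∀ H ∈ F', H.apex = b) (hCΓ : C ⊆ inter Γ)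
    (hCD : C ⊆ D) (hDF : D ⊆ inter F) (hDF' : D ⊆ inter F')
    (hD : inter Γ ∩ inter F ⊆ D) (hD' : inter Γ ∩ inter F' ⊆ D) : inter Γ ⊆ D := by
  obtain ⟨a, haC, rfl⟩ := ha
  obtain ⟨b, hbC, rfl⟩ := hb
  intro x hx
  by_contra hxD
  have hxF : x ∉ inter F := fun h => hxD (hD ⟨hx, h⟩)
  have hxF' : x ∉ inter F' := fun h => hxD (hD' ⟨hx, h⟩)
  rw [mem_inter] at hxF hxF'
  push Not at hxF hxF'
  obtain ⟨H, hH, hxH⟩ := hxF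
  obtain ⟨H', hH', hxH'⟩ := hxF'
  obtain ⟨s, hs, hs'⟩ := exists_max_level (exists_ne_bot_of_notMem hxH) a
  obtain ⟨u, hu, hu'⟩ := exists_max_level (exists_ne_bot_of_notMem hxH) b
  have h1 := max_level_add_le (hF H hH).symm (fun H' h => (hF' H' h).symm) (hCΓ haC)
    (hDF' (hCD haC)) (hDF.trans (inter_subset hH)) hD' hx hxH hs hs' hu'
  have h2 := max_level_add_le (hF' H' hH').symm (fun H' h => (hF H' h).symm) (hCΓ hbC)
    (hDF (hCD hbC)) (hDF'.trans (inter_subset hH')) hD hx hxH' hu hu' hs'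
  exact hab (RealProj.mk_eq_mk.2 ⟨s - u, fun i => by linarith [h1 i, h2 i]⟩)

end AntiExchange

/-! ### Active generators and cone membership -/

section GeneratedCones

variable {n p : ℕ} {v : Fin p → Fin n → ℝ}

theorem generator_mem (v : Fin p → Fin n → ℝ) (r : Fin p) :
    (fun i => (v r i : MaxPlus)) ∈ generatedCone v := by
  refine ⟨fun s => if s = r then 0 else ⊥, fun i => le_antisymm ?_ ?_⟩
  · refine le_trans ?_ (Finset.le_sup (Finset.mem_univ r))
    simp
  · refine Finset.sup_le fun s _ => ?_
    by_cases h : s = r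
    · subst h; simp
    · simp [h]

/-- The `i`-th coordinate attains the maximum of `v r - a`. -/
def Active (v : Fin p → Fin n → ℝ) (a : Fin n → ℝ) (r : Fin p) (i : Fin n) : Prop :=
  ∀ k, v r k - a k ≤ v r i - a i

/-- A real point is a combination of the generators exactly when every coordinate is touched by some
generator, scaled to be as large as possible below the point. This turns membership into a finite
combinatorial condition. -/
theorem coe_mem_generatedCone {a : Fin n → ℝ} :
    (fun i => (a i : MaxPlus)) ∈ generatedCone v ↔ ∀ i, ∃ r, Active v a r i := by
  constructor
  · rintro ⟨l, hl⟩ i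
    have hne : (⊥ : MaxPlus) < (a i : MaxPlus) := WithBot.bot_lt_coe _
    obtain ⟨r, -, hr⟩ := (Finset.le_sup_iff hne).1 (hl i).le
    refine ⟨r, fun k => ?_⟩
    have hk : l r + (v r k : MaxPlus) ≤ (a k : MaxPlus) :=
      (Finset.le_sup (f := fun r => l r + (v r k : MaxPlus)) (Finset.mem_univ r)).trans (hl k).ge
    induction hlr : l r using WithBot.recBotCoe with
    | bot => rw [hlr] at hr; simp at hr
    | coe c =>
      rw [hlr, ← WithBot.coe_add, WithBot.coe_le_coe] at hr hk
      linarith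
  · intro h
    choose r hr using h
    -- All `i` assigned to the same `s` give the same value, the minimum of `a - v s`. A generator
    -- that is never chosen gets `⊥`.
    refine ⟨fun s => Finset.univ.sup fun i => if r i = s then ((a i - v s i : ℝ) : MaxPlus) else ⊥,
      fun i => le_antisymm ?_ ?_⟩
    · refine le_trans ?_ (Finset.le_sup (Finset.mem_univ (r i)))
      have : ((a i - v (r i) i : ℝ) : MaxPlus) ≤ Finset.univ.sup fun k =>
          if r k = r i then ((a k - v (r i) k : ℝ) : MaxPlus) else ⊥ := by
        refine le_trans ?_ (Finset.le_sup (Finset.mem_univ i))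
        simp
      refine le_trans ?_ (add_le_add_left this _)
      rw [← WithBot.coe_add, sub_add_cancel]
    · refine Finset.sup_le fun s _ => ?_
      have : (Finset.univ.sup fun k => if r k = s then ((a k - v s k : ℝ) : MaxPlus) else ⊥) ≤
          ((a i - v s i : ℝ) : MaxPlus) := by
        refine Finset.sup_le fun k _ => ?_
        split_ifs with hk
        · subst hk
          exact WithBot.coe_le_coe.2 (by linarith [hr k i])
        · exact bot_le
      refine (add_le_add_left this _).trans ?_
      rw [← WithBot.coe_add, sub_add_cancel]

theorem Active.shift {a b : Fin n → ℝ} {c : ℝ} (h : ∀ i, b i = c + a i) {r : Fin p} {i : Fin n}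
    (ha : Active v a r i) : Active v b r i := fun k => by
  rw [h, h]; linarith [ha k]

theorem mk_mem_projImage {a : Fin n → ℝ} :
    RealProj.mk a ∈ projImage (generatedCone v) ↔ ∀ i, ∃ r, Active v a r i := by
  constructor
  · rintro ⟨x, hx, hxa⟩ i
    obtain ⟨c, hc⟩ := RealProj.mk_eq_mk.1 hxa
    obtain ⟨r, hr⟩ := coe_mem_generatedCone.1 hx i
    exact ⟨r, hr.shift hc⟩
  · exact fun h => ⟨a, coe_mem_generatedCone.2 h, rfl⟩

theorem generatedCone_subset_halfSpaceSet {a : Fin n → ℝ} {I : Finset (Fin n)} (hI : I.Nonempty)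
    (h : ∀ r, ∃ k ∈ I, Active v a r k) : generatedCone v ⊆ halfSpaceSet a I := by
  rintro x ⟨l, hl⟩
  rw [mem_halfSpaceSet_iff_level hI]
  intro t j hj
  rw [hl j] at hj
  obtain ⟨r, -, hr⟩ := (Finset.le_sup_iff (WithBot.bot_lt_coe _)).1 hj
  obtain ⟨k, hk, hrk⟩ := h r
  refine ⟨k, hk, ?_⟩
  rw [hl k]
  refine le_trans ?_ (Finset.le_sup (Finset.mem_univ r))
  induction hlr : l r using WithBot.recBotCoe with
  | bot => rw [hlr] at hr; simp at hr
  | coe c =>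
    rw [hlr, ← WithBot.coe_add, WithBot.coe_le_coe] at hr
    rw [← WithBot.coe_add, WithBot.coe_le_coe]
    linarith [hrk j]

end GeneratedCones

/-! ### Boundary points as apices -/

section Boundary

variable {n p : ℕ} {v : Fin p → Fin n → ℝ}

theorem eventually_sub_lt {a : Fin n → ℝ} {i j : Fin n} {s : ℝ} (h : a j - a i < s) :
    ∀ᶠ b in nhds (RealProj.mk a), ∀ y, RealProj.mk y = b → y j - y i < s := by
  refine Filter.mem_of_superset (Metric.ball_mem_nhds _ (sub_pos.2 h)) ?_
  rintro _ hb y rfl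
  have h1 : hilbertDist y a < s - (a j - a i) := hb
  linarith [sub_sub_le_hilbertDist y a j i]

/-- Non-membership means that at some coordinate every generator is strictly beaten elsewhere. These
finitely many strict inequalities persist nearby. -/
theorem isClosed_projImage (v : Fin p → Fin n → ℝ) : IsClosed (projImage (generatedCone v)) := by
  rw [← isOpen_compl_iff, isOpen_iff_mem_nhds]
  intro a ha
  obtain ⟨a, rfl⟩ := a.exists_rep
  rw [Set.mem_compl_iff, mk_mem_projImage] at ha
  simp only [Active] at ha
  push Not at ha
  obtain ⟨i, hi⟩ := ha
  choose j hj using hi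
  have := fun r => eventually_sub_lt (a := a) (i := i) (j := j r) (s := v r (j r) - v r i)
    (by linarith [hj r])
  filter_upwards [Filter.eventually_all.2 this] with b hb
  obtain ⟨y, rfl⟩ := b.exists_rep
  rw [Set.mem_compl_iff, mk_mem_projImage]
  intro h
  obtain ⟨r, hr⟩ := h i
  linarith [hr (j r), hb r y rfl]

theorem boundary_subset (v : Fin p → Fin n → ℝ) :
    boundary (generatedCone v) ⊆ projImage (generatedCone v) :=
  (isClosed_projImage v).frontier_subset

theorem mem_suppAt {C : Set (Fin n → MaxPlus)} {a : RealProj n} {H : HalfSpace n} :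
    H ∈ suppAt C a ↔ H.apex = a ∧ C ⊆ (H : Set (Fin n → MaxPlus)) := Iff.rfl

/-- If every coordinate `i` were the unique maximum of some `v r - a`, this would persist near `a`,
making it an interior point. So for some `i` every generator attains its maximum off `i`, and the
half-space with sectors `{i}ᶜ` contains the cone. -/
theorem suppAt_nonempty {a : RealProj n} (ha : a ∈ boundary (generatedCone v)) :
    (suppAt (generatedCone v) a).Nonempty := by
  have haC := boundary_subset v ha
  obtain ⟨a, rfl⟩ := a.exists_rep
  rw [mk_mem_projImage] at haC
  by_cases h : ∀ i, ∃ r, ∀ j, j ≠ i → v r j - a j < v r i - a i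
  · refine absurd (mem_interior_iff_mem_nhds.2 ?_) ha.2
    choose r hr using h
    have : ∀ i j, ∀ᶠ b in nhds (RealProj.mk a), ∀ y, RealProj.mk y = b →
        v (r i) j - y j ≤ v (r i) i - y i := by
      intro i j
      by_cases hji : j = i
      · subst hji; simp
      · filter_upwards [eventually_sub_lt (a := a) (i := j) (j := i)
          (s := v (r i) i - v (r i) j) (by linarith [hr i j hji])] with b hb y hy
        linarith [hb y hy]
    filter_upwards [Filter.eventually_all.2 fun i => Filter.eventually_all.2 (this i)] with b hb
    obtain ⟨y, rfl⟩ := b.exists_rep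
    exact mk_mem_projImage.2 fun i => ⟨r i, fun j => hb i j y rfl⟩
  · push Not at h
    obtain ⟨i, hi⟩ := h
    have hI : ({i}ᶜ : Finset (Fin n)).Nonempty := by
      obtain ⟨r, -⟩ := haC i
      obtain ⟨j, hj, -⟩ := hi r
      exact ⟨j, by simpa using hj⟩
    refine ⟨⟨RealProj.mk a, {i}ᶜ, hI, by simp⟩, rfl, ?_⟩
    refine fun x hx => (HalfSpace.mem_iff rfl).2 (generatedCone_subset_halfSpaceSet hI ?_ hx)
    intro r
    obtain ⟨k, hk⟩ := @Finite.exists_max _ _ _ ⟨i⟩ _ fun k => v r k - a k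
    by_cases hki : k = i
    · subst hki
      obtain ⟨j, hj, hle⟩ := hi r
      exact ⟨j, by simpa using hj, fun l => (hk l).trans hle⟩
    · exact ⟨k, by simpa using hki, hk⟩

/-- Raising the apex slightly in a coordinate outside the sectors leaves the half-space, hence the
cone. -/
theorem apex_mem_boundary {C : Set (Fin n → MaxPlus)} {H : HalfSpace n} (hH : H ∈ supp C) :
    H.apex ∈ boundary C := by
  refine ⟨subset_closure hH.2, fun hint => ?_⟩
  obtain ⟨ε, hε, hball⟩ := Metric.mem_nhds_iff.1 (mem_interior_iff_mem_nhds.1 hint)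
  obtain ⟨a, ha⟩ := H.apex.exists_rep
  obtain ⟨j, hj⟩ := H.compl_nonempty
  rw [Finset.mem_compl] at hj
  have : Nonempty (Fin n) := ⟨j⟩
  have hmem : RealProj.mk (a + Pi.single j (ε / 2)) ∈ projImage C := by
    apply hball
    rw [Metric.mem_ball, ← ha]
    refine lt_of_le_of_lt (b := ε / 2) ?_ (by linarith)
    change hilbertDist _ _ ≤ _
    rw [hilbertDist_le_iff]
    intro i k
    simp only [Pi.add_apply, Pi.single_apply]
    split_ifs <;> linarith
  obtain ⟨x, hxC, hx⟩ := hmem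
  obtain ⟨c, hc⟩ := RealProj.mk_eq_mk.1 hx
  have hxH := hH.1 hxC
  rw [HalfSpace.mem_iff ha, coe_mem_halfSpaceSet_iff_level H.sect_nonempty] at hxH
  have hj' := hc j
  simp only [Pi.add_apply, Pi.single_eq_same] at hj'
  obtain ⟨i, hi, hle⟩ := hxH (ε / 2 - c) j (by linarith)
  have hij : i ≠ j := fun e => hj (e ▸ hi)
  have hi' := hc i
  simp only [Pi.add_apply, Pi.single_eq_of_ne hij] at hi'
  linarith

end Boundary

/-! ### Finitely many apices suffice -/

section FiniteRepresentation

variable {n p : ℕ} {v : Fin p → Fin n → ℝ}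

open Classical in
/-- The set of pairs `(r, i)` such that `v r - a` is maximal at `i`. -/
noncomputable def activeSet (v : Fin p → Fin n → ℝ) (a : Fin n → ℝ) : Finset (Fin p × Fin n) :=
  Finset.univ.filter fun q => Active v a q.1 q.2

theorem mem_activeSet {a : Fin n → ℝ} {r : Fin p} {i : Fin n} :
    (r, i) ∈ activeSet v a ↔ Active v a r i := by
  simp [activeSet]

/-- The vertices of the cell complex of `v`: no proper set of coordinates is a union of classes
linked by the active sets. -/
def IsVertex (v : Fin p → Fin n → ℝ) (a : Fin n → ℝ) : Prop :=
  ∀ W : Set (Fin n), W.Nonempty →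
    (∀ r, (∀ i, Active v a r i → i ∈ W) ∨ ∀ i, Active v a r i → i ∉ W) → W = Set.univ

/-- Two coordinates active for a common generator at both points have the same value of `b - a`. The
level sets of `b - a` are therefore unions of classes, so `b - a` is constant at a vertex. -/
theorem IsVertex.mk_eq_mk {a b : Fin n → ℝ} (ha : IsVertex v a)
    (h : activeSet v a = activeSet v b) : RealProj.mk a = RealProj.mk b := by
  have hact : ∀ r i, Active v a r i → Active v b r i := fun r i hi =>
    mem_activeSet.1 (h ▸ mem_activeSet.2 hi)
  rcases isEmpty_or_nonempty (Fin n) with hn | ⟨⟨j⟩⟩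
  · exact RealProj.mk_eq_mk.2 ⟨0, fun i => hn.elim i⟩
  have hW := ha {i | b i - a i = b j - a j} ⟨j, rfl⟩ fun r => by
    by_cases hr : ∃ i, Active v a r i ∧ b i - a i = b j - a j
    · obtain ⟨i, hi, hij⟩ := hr
      refine Or.inl fun k hk => ?_
      have h1 := hi k
      have h2 := hk i
      have h3 := hact r i hi k
      have h4 := hact r k hk i
      change b k - a k = b j - a j
      linarith
    · exact Or.inr fun i hi hij => hr ⟨i, hi, hij⟩
  refine RealProj.mk_eq_mk.2 ⟨b j - a j, fun i => ?_⟩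
  have : b i - a i = b j - a j := (Set.ext_iff.1 hW i).2 trivial
  linarith

theorem finite_vertices (v : Fin p → Fin n → ℝ) : (RealProj.mk '' {a | IsVertex v a}).Finite := by
  refine (Set.finite_range fun T =>
    RealProj.mk (Function.invFunOn (activeSet v) {a | IsVertex v a} T)).subset ?_
  rintro _ ⟨a, ha, rfl⟩
  have hex : ∃ b ∈ {a | IsVertex v a}, activeSet v b = activeSet v a := ⟨a, ha, rfl⟩
  exact ⟨activeSet v a,
    (IsVertex.mk_eq_mk (Function.invFunOn_mem hex) (Function.invFunOn_eq hex))⟩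

/-- Lowering the coordinates of a union of classes until a new active pair appears. -/
theorem exists_lower {a : Fin n → ℝ} (ha : ∀ i, ∃ r, Active v a r i) {W : Set (Fin n)} {j : Fin n}
    (hj : j ∈ W)
    (hW : ∀ r, (∀ i, Active v a r i → i ∈ W) ∨ ∀ i, Active v a r i → i ∉ W)
    (hne : W ≠ Set.univ) :
    ∃ b : Fin n → ℝ, activeSet v a ⊂ activeSet v b ∧ ∀ i, a j - b j ≥ a i - b i := by
  classical
  have : Nonempty (Fin n) := ⟨j⟩
  choose m hm using fun r => Finite.exists_max fun k => v r k - a k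
  have hm' : ∀ r, Active v a r (m r) := hm
  -- Lowering `a` on `W` raises `v r - a` there, which only threatens generators whose maximum lies
  -- outside `W`. The least slack over these pairs is the exact amount by which to lower.
  let S : Finset (Fin p × Fin n) := Finset.univ.filter fun q => m q.1 ∉ W ∧ q.2 ∈ W
  have hdisj : ∀ r, m r ∉ W → ∀ i, Active v a r i → i ∉ W := fun r hr =>
    (hW r).resolve_left fun h => hr (h _ (hm' r))
  have hS : S.Nonempty := by
    obtain ⟨k, hk⟩ := (Set.ne_univ_iff_exists_notMem W).1 hne
    obtain ⟨r, hr⟩ := ha k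
    refine ⟨(r, j), ?_⟩
    simp only [S, Finset.mem_filter, Finset.mem_univ, true_and]
    exact ⟨fun h => hk ((hW r).resolve_right (fun h' => h' _ (hm' r) h) _ hr), hj⟩
  obtain ⟨⟨r₀, i₀⟩, hmem, hmin⟩ := S.exists_min_image
    (fun q => (v q.1 (m q.1) - a (m q.1)) - (v q.1 q.2 - a q.2)) hS
  simp only [S, Finset.mem_filter, Finset.mem_univ, true_and, Prod.forall] at hmem hmin
  obtain ⟨hr₀, hi₀⟩ := hmem
  set t : ℝ := (v r₀ (m r₀) - a (m r₀)) - (v r₀ i₀ - a i₀) with ht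
  have ht0 : 0 ≤ t := by linarith [hm r₀ i₀]
  let b : Fin n → ℝ := fun i => if i ∈ W then a i - t else a i
  have hbW : ∀ i ∈ W, b i = a i - t := fun i hi => if_pos hi
  have hbW' : ∀ i ∉ W, b i = a i := fun i hi => if_neg hi
  refine ⟨b, ?_, fun i => ?_⟩
  · refine (Finset.ssubset_iff_of_subset ?_).2 ⟨(r₀, i₀), ?_, ?_⟩
    · rintro ⟨r, i⟩ hri
      rw [mem_activeSet] at hri ⊢
      intro k
      by_cases hmW : m r ∈ W
      · have hi := (hW r).resolve_right (fun h => h _ (hm' r) hmW) i hri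
        rw [hbW i hi]
        by_cases hk : k ∈ W
        · rw [hbW k hk]; linarith [hri k]
        · rw [hbW' k hk]; linarith [hri k]
      · rw [hbW' i (hdisj r hmW i hri)]
        by_cases hk : k ∈ W
        · rw [hbW k hk]; linarith [hmin r k ⟨hmW, hk⟩, hri (m r)]
        · rw [hbW' k hk]; linarith [hri k]
    · rw [mem_activeSet]
      intro k
      rw [hbW i₀ hi₀]
      by_cases hk : k ∈ W
      · rw [hbW k hk]; linarith [hmin r₀ k ⟨hr₀, hk⟩]
      · rw [hbW' k hk]; linarith [hm r₀ k]
    · rw [mem_activeSet]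
      exact fun h => hdisj r₀ hr₀ i₀ h hi₀
  · rw [hbW j hj]
    by_cases hi : i ∈ W
    · rw [hbW i hi]; linarith
    · rw [hbW' i hi]; linarith

/-- A half-space separating a real vector from the cone, with apex in the cone. -/
theorem exists_separating [Nonempty (Fin p)] {x : Fin n → ℝ}
    (hx : (fun i => (x i : MaxPlus)) ∉ generatedCone v) :
    ∃ (a : Fin n → ℝ) (I : Finset (Fin n)) (j : Fin n), (∀ i, ∃ r, Active v a r i) ∧
      (∀ r, ∃ k ∈ I, Active v a r k) ∧ ∀ i ∈ I, x i - a i < x j - a j := by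
  classical
  have hn : Nonempty (Fin n) := by
    by_contra h
    exact hx (coe_mem_generatedCone.2 fun i => (h ⟨i⟩).elim)
  choose k hk using fun r => Finite.exists_min fun i => x i - v r i
  choose q hq using fun i => Finite.exists_max fun r => (x (k r) - v r (k r)) + v r i
  -- The projection of `x` onto the cone: the supremum of all generators, each scaled as large as
  -- possible below `x`. The sectors will be the coordinates where it agrees with `x`.
  let a : Fin n → ℝ := fun i => (x (k (q i)) - v (q i) (k (q i))) + v (q i) i
  have hale : ∀ r i, (x (k r) - v r (k r)) + v r i ≤ a i := fun r i => hq i r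
  have hax : ∀ i, a i ≤ x i := fun i => by
    change (x (k (q i)) - v (q i) (k (q i))) + v (q i) i ≤ x i
    linarith [hk (q i) i]
  have hak : ∀ r, a (k r) = x (k r) := fun r =>
    le_antisymm (hax _) (by linarith [hale r (k r)])
  have haC : ∀ i, ∃ r, Active v a r i := fun i => ⟨q i, fun l => by
    have h1 : a i = (x (k (q i)) - v (q i) (k (q i))) + v (q i) i := rfl
    linarith [hale (q i) l]⟩
  have hj : ∃ j, a j ≠ x j := by
    by_contra! h
    exact hx (coe_mem_generatedCone.2 (funext h ▸ haC))
  obtain ⟨j, hj⟩ := hj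
  refine ⟨a, Finset.univ.filter fun i => a i = x i, j, haC, fun r => ⟨k r, by simp [hak], ?_⟩, ?_⟩
  · intro l
    linarith [hale r l, hak r]
  · intro i hi
    have hi' : a i = x i := by simpa using hi
    linarith [lt_of_le_of_ne (hax j) hj]

/-- Keep `I` and `j`, and choose a separating apex with maximal active set. At a non-vertex,
lowering a proper union of classes containing `j` would enlarge the active set and keep the
separation, because `j` drops at least as much as any other coordinate. -/
theorem exists_vertex_separating [Nonempty (Fin p)] {x : Fin n → ℝ}
    (hx : (fun i => (x i : MaxPlus)) ∉ generatedCone v) :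
    ∃ (a : Fin n → ℝ) (I : Finset (Fin n)) (j : Fin n), IsVertex v a ∧
      (∀ i, ∃ r, Active v a r i) ∧ (∀ r, ∃ k ∈ I, Active v a r k) ∧
      ∀ i ∈ I, x i - a i < x j - a j := by
  obtain ⟨a₀, I, j, h₀⟩ := exists_separating hx
  let P : (Fin n → ℝ) → Prop := fun a => (∀ i, ∃ r, Active v a r i) ∧
    (∀ r, ∃ k ∈ I, Active v a r k) ∧ ∀ i ∈ I, x i - a i < x j - a j
  obtain ⟨T, hT⟩ := (Set.toFinite (activeSet v '' {a | P a})).exists_maximal ⟨_, a₀, h₀, rfl⟩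
  obtain ⟨⟨a, ha, rfl⟩, hmax⟩ := hT
  refine ⟨a, I, j, fun W hWne hW => ?_, ha⟩
  obtain ⟨h1, h2, h3⟩ := ha
  have key : ∀ W : Set (Fin n), j ∈ W →
      (∀ r, (∀ i, Active v a r i → i ∈ W) ∨ ∀ i, Active v a r i → i ∉ W) → W = Set.univ := by
    intro W hjW hW
    by_contra hne
    obtain ⟨b, hb, hb'⟩ := exists_lower h1 hjW hW hne
    have hact : ∀ r i, Active v a r i → Active v b r i := fun r i h =>
      mem_activeSet.1 (hb.1 (mem_activeSet.2 h))
    refine hb.2 (hmax ⟨b, ⟨fun i => ?_, fun r => ?_, fun i hi => ?_⟩, rfl⟩ hb.1)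
    · obtain ⟨r, hr⟩ := h1 i
      exact ⟨r, hact r i hr⟩
    · obtain ⟨k, hk, hr⟩ := h2 r
      exact ⟨k, hk, hact r k hr⟩
    · linarith [h3 i hi, hb' i]
  -- The complement of a union of classes is again one, so one of the two contains `j`.
  by_cases hjW : j ∈ W
  · exact key W hjW hW
  · have := key Wᶜ hjW fun r => (hW r).symm.imp id fun h i hi hi' => hi' (h i hi)
    rw [Set.compl_univ_iff] at this
    exact absurd this hWne.ne_empty

/-- Reduces membership to real vectors. The real points of the cone have bounded coordinate
differences, so a vector with both real and `⊥` entries fails the hypothesis for very negative `c`.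
-/
theorem mem_of_forall_sup_mem {x : Fin n → MaxPlus} (r₀ : Fin p)
    (h : ∀ y : Fin n → ℝ, (∃ c : ℝ, ∀ i, (y i : MaxPlus) = x i ⊔ ((c + v r₀ i : ℝ) : MaxPlus)) →
      (fun i => (y i : MaxPlus)) ∈ generatedCone v) : x ∈ generatedCone v := by
  have hreal : ∀ c : ℝ, ∃ y : Fin n → ℝ, ∀ i,
      (y i : MaxPlus) = x i ⊔ ((c + v r₀ i : ℝ) : MaxPlus) := fun c => by
    have : ∀ i, ∃ w : ℝ, (w : MaxPlus) = x i ⊔ ((c + v r₀ i : ℝ) : MaxPlus) := fun i =>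
      WithBot.ne_bot_iff_exists.1 (ne_bot_of_le_ne_bot WithBot.coe_ne_bot le_sup_right)
    choose y hy using this
    exact ⟨y, hy⟩
  by_cases hbot : ∃ k, x k = ⊥
  · obtain ⟨k, hk⟩ := hbot
    by_cases hx : ∃ j, x j ≠ ⊥
    · obtain ⟨j, hj⟩ := hx
      obtain ⟨u, hu⟩ := WithBot.ne_bot_iff_exists.1 hj
      have : Nonempty (Fin p) := ⟨r₀⟩
      obtain ⟨s, hs⟩ := Finite.exists_max fun r => v r j - v r k
      -- Makes `y k` one less than `u` minus the largest difference `v r j - v r k`, so that `y j -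
      -- y k` exceeds what any generator active at `j` allows.
      obtain ⟨y, hy⟩ := hreal (u - (v s j - v s k) - v r₀ k - 1)
      obtain ⟨r, hr⟩ := coe_mem_generatedCone.1 (h y ⟨_, hy⟩) j
      have hyk := hy k
      rw [hk, bot_sup_eq, WithBot.coe_inj] at hyk
      have hyj : u ≤ y j := by
        rw [← WithBot.coe_le_coe, hy j, hu]
        exact le_sup_left
      linarith [hr k, hs r]
    · push Not at hx
      exact ⟨fun _ => ⊥, fun i => by simp [hx i]⟩
  · push Not at hbot
    choose w hw using fun i => WithBot.ne_bot_iff_exists.1 (hbot i)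
    rcases isEmpty_or_nonempty (Fin n) with hn | hn
    · exact ⟨fun _ => ⊥, fun i => hn.elim i⟩
    obtain ⟨k, hk⟩ := Finite.exists_min fun i => w i - v r₀ i
    have hxw : x = fun i => (w i : MaxPlus) := funext fun i => (hw i).symm
    rw [hxw]
    refine h w ⟨w k - v r₀ k, fun i => ?_⟩
    rw [← hw i, eq_comm, sup_eq_left, WithBot.coe_le_coe]
    linarith [hk i]

/-- A real polyhedral cone is the intersection of the half-spaces of `Σ` whose apices belong to
some finite set. -/
theorem exists_finite_apices (v : Fin p → Fin n → ℝ) [Nonempty (Fin p)] :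
    ∃ X ⊆ boundary (generatedCone v), X.Finite ∧
      inter (⋃ b ∈ X, suppAt (generatedCone v) b) ⊆ generatedCone v := by
  refine ⟨RealProj.mk '' {a | IsVertex v a} ∩ boundary (generatedCone v), Set.inter_subset_right,
    (finite_vertices v).inter_of_left _, fun x hx => ?_⟩
  have r₀ : Fin p := Classical.arbitrary _
  refine mem_of_forall_sup_mem r₀ ?_
  rintro y ⟨c, hy⟩
  by_contra hyC
  obtain ⟨a, I, j, hv, haC, hI, hj⟩ := exists_vertex_separating hyC
  have hIne : I.Nonempty := let ⟨k, hk, _⟩ := hI r₀; ⟨k, hk⟩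
  have hjI : j ∉ I := fun h => lt_irrefl _ (hj j h)
  let H : HalfSpace n := ⟨RealProj.mk a, I, hIne, ⟨j, Finset.mem_compl.2 hjI⟩⟩
  have hCH : generatedCone v ⊆ (H : Set (Fin n → MaxPlus)) := fun z hz =>
    (HalfSpace.mem_iff rfl).2 (generatedCone_subset_halfSpaceSet hIne hI hz)
  have hHb : H.apex ∈ boundary (generatedCone v) :=
    apex_mem_boundary ⟨hCH, mk_mem_projImage.2 haC⟩
  have hyI : (fun i => x i ⊔ ((c + v r₀ i : ℝ) : MaxPlus)) ∈
      inter (⋃ b ∈ RealProj.mk '' {a | IsVertex v a} ∩ boundary (generatedCone v),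
        suppAt (generatedCone v) b) := by
    refine sup_coe_mem_inter hx (mem_inter.2 fun H' hH' => ?_) c
    simp only [Set.mem_iUnion] at hH'
    obtain ⟨b, -, hb⟩ := hH'
    exact hb.2 (generator_mem v r₀)
  rw [← funext hy] at hyI
  have hyH := mem_inter.1 hyI H
    (Set.mem_biUnion (x := RealProj.mk a) ⟨⟨a, hv, rfl⟩, hHb⟩ ⟨rfl, hCH⟩)
  rw [HalfSpace.mem_iff (a := a) rfl, coe_mem_halfSpaceSet_iff_level hIne] at hyH
  obtain ⟨i, hi, hle⟩ := hyH (y j - a j) j (by linarith)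
  linarith [hj i hi]

end FiniteRepresentation

/-! ### Spanning sets and uniqueness -/

section Closure

variable {n : ℕ} {C : Set (Fin n → MaxPlus)}

/-- The half-spaces containing `C` with apex in `X`. -/
def suppOn (C : Set (Fin n → MaxPlus)) (X : Set (RealProj n)) : Set (HalfSpace n) :=
  ⋃ b ∈ X, suppAt C b

theorem mem_suppOn {X : Set (RealProj n)} {H : HalfSpace n} :
    H ∈ suppOn C X ↔ H.apex ∈ X ∧ C ⊆ (H : Set (Fin n → MaxPlus)) := by
  simp only [suppOn, Set.mem_iUnion, mem_suppAt, exists_prop]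
  exact ⟨fun ⟨b, hb, h, hC⟩ => ⟨h ▸ hb, hC⟩, fun ⟨h, hC⟩ => ⟨_, h, rfl, hC⟩⟩

theorem suppOn_mono {X Y : Set (RealProj n)} (h : X ⊆ Y) : suppOn C X ⊆ suppOn C Y :=
  Set.biUnion_subset_biUnion_left h

theorem mem_tau {Γ : Set (HalfSpace n)} {H : HalfSpace n} :
    H ∈ tau C Γ ↔ H ∈ supp C ∧ inter Γ ⊆ (H : Set (Fin n → MaxPlus)) := Iff.rfl

theorem subset_inter_suppOn (X : Set (RealProj n)) : C ⊆ inter (suppOn C X) := fun _ hx =>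
  mem_inter.2 fun _ hH => (mem_suppOn.1 hH).2 hx

theorem subset_inter_supp : C ⊆ inter (supp C) := fun _ hx =>
  mem_inter.2 fun _ hH => hH.1 hx

theorem HalfSpace.ne_univ (H : HalfSpace n) : (H : Set (Fin n → MaxPlus)) ≠ Set.univ := by
  intro h
  obtain ⟨a, ha⟩ := H.apex.exists_rep
  obtain ⟨k, hk⟩ := H.compl_nonempty
  have : Function.update (⊥ : Fin n → MaxPlus) k (0 : ℝ) ∈ (H : Set (Fin n → MaxPlus)) :=
    h ▸ trivial
  rw [HalfSpace.mem_iff ha, single_mem_halfSpaceSet H.sect_nonempty] at this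
  exact Finset.mem_compl.1 hk this

theorem suppAt_subset_supp (hcl : boundary C ⊆ projImage C) {a : RealProj n}
    (ha : a ∈ boundary C) : suppAt C a ⊆ supp C := fun _ hH => ⟨hH.2, hH.1 ▸ hcl ha⟩

/-- Only `empty` is not formal: each boundary point carries a supporting half-space, which is never
the whole space. -/
theorem isClosureOperatorOn_tau' (hcl : boundary C ⊆ projImage C)
    (hne : ∀ a ∈ boundary C, (suppAt C a).Nonempty) :
    IsClosureOperatorOn (boundary C) (tau' C) where
  subset_ground _ _ _ ha := ha.1
  empty := by
    rw [Set.eq_empty_iff_forall_notMem]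
    intro a ha
    obtain ⟨H, hH⟩ := hne a ha.1
    have := (ha.2 hH).2
    simp only [Set.mem_empty_iff_false, Set.iUnion_false, Set.iUnion_empty, Set.iInter_false,
      Set.iInter_univ, Set.univ_subset_iff] at this
    exact H.ne_univ this
  extensive X hX a ha := ⟨hX ha, fun H hH =>
    ⟨suppAt_subset_supp hcl (hX ha) hH, inter_subset (mem_suppOn.2 ⟨hH.1 ▸ ha, hH.2⟩)⟩⟩
  monotone X _ Y _ hXY a ha := ⟨ha.1, fun H hH =>
    ⟨(ha.2 hH).1, (inter_anti (suppOn_mono hXY)).trans (ha.2 hH).2⟩⟩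
  idempotent X hX := by
    refine Set.Subset.antisymm (fun a ha => ⟨ha.1, fun H hH => ⟨(ha.2 hH).1, ?_⟩⟩)
      fun a ha => ⟨ha.1, fun H hH =>
        ⟨(ha.2 hH).1, inter_subset (mem_suppOn.2 ⟨hH.1 ▸ ha, hH.2⟩)⟩⟩
    refine subset_trans (fun x hx => mem_inter.2 fun H' hH' => ?_) (ha.2 hH).2
    obtain ⟨h1, h2⟩ := mem_suppOn.1 hH'
    exact (h1.2 ⟨rfl, h2⟩).2 hx

/-- Every half-space of `supp C` has its apex on the boundary, so spanning is a statement about the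
hull alone. The hull is used instead of `C` because they differ when there are no generators and `n
> 0`. -/
theorem isFiniteSpanning_iff (hcl : boundary C ⊆ projImage C) {X : Set (RealProj n)} :
    IsFiniteSpanning C X ↔
      X ⊆ boundary C ∧ X.Finite ∧ inter (suppOn C X) ⊆ inter (supp C) := by
  refine and_congr_right fun hX => and_congr_right fun _ => ?_
  constructor
  · intro h x hx
    refine mem_inter.2 fun H hH => ?_
    have ha : H.apex ∈ tau' C X := h ▸ apex_mem_boundary hH
    exact (ha.2 ⟨rfl, hH.1⟩).2 hx
  · intro h
    refine Set.Subset.antisymm (fun a ha => ha.1) fun a ha => ⟨ha, fun H hH => ?_⟩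
    have hs := suppAt_subset_supp hcl ha hH
    exact ⟨hs, h.trans (inter_subset hs)⟩

/-- If `⋂ Γ` is reduced to the hull of `C` by half-spaces with apex `a`, and also by half-spaces
with apices in a finite set that does not contain `a`, then it is already this hull. -/
theorem inter_subset_of_notMem (hcl : boundary C ⊆ projImage C) {a : RealProj n}
    (ha : a ∈ boundary C) {F : Set (HalfSpace n)} (hF : F ⊆ suppAt C a) {Y : Set (RealProj n)}
    (hY : Y.Finite) : Y ⊆ boundary C → a ∉ Y → ∀ Γ : Set (HalfSpace n), C ⊆ inter Γ →
      inter Γ ∩ inter F ⊆ inter (supp C) → inter Γ ∩ inter (suppOn C Y) ⊆ inter (supp C) →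
      inter Γ ⊆ inter (supp C) := by
  induction Y, hY using Set.Finite.induction_on with
  | empty =>
    intro _ _ Γ _ _ h x hx
    exact h ⟨hx, mem_inter.2 fun H hH => absurd (mem_suppOn.1 hH).1 (Set.notMem_empty _)⟩
  | @insert b Y _ _ ih =>
    intro hYC haY Γ hΓ h1 h2
    have hb : b ∈ boundary C := hYC (Set.mem_insert _ _)
    have hab : a ≠ b := fun e => haY (e ▸ Set.mem_insert _ _)
    -- Absorbing `b` into `Γ` leaves only `Y` for the induction hypothesis. Then `a` and `b` each
    -- complete `Γ` to the hull, and anti-exchange removes both.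
    have h3 : inter (Γ ∪ suppAt C b) ⊆ inter (supp C) := by
      refine ih ((Set.subset_insert _ _).trans hYC) (fun h => haY (Set.mem_insert_of_mem _ h)) _
        ?_ ?_ ?_
      · rw [inter_union]
        exact fun x hx => ⟨hΓ hx, mem_inter.2 fun H hH => hH.2 hx⟩
      · rw [inter_union]
        exact fun x hx => h1 ⟨hx.1.1, hx.2⟩
      · rw [inter_union]
        refine fun x hx => h2 ⟨hx.1.1, mem_inter.2 fun H hH => ?_⟩
        obtain ⟨hHY, hHC⟩ := mem_suppOn.1 hH
        rcases hHY with hHb | hHY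
        · exact mem_inter.1 hx.1.2 H ⟨hHb, hHC⟩
        · exact mem_inter.1 hx.2 H (mem_suppOn.2 ⟨hHY, hHC⟩)
    rw [inter_union] at h3
    exact inter_subset_of_ne_apex hab (hcl ha) (hcl hb) (fun H hH => (hF hH).1)
      (fun H hH => hH.1) hΓ subset_inter_supp
      (inter_anti (hF.trans (suppAt_subset_supp hcl ha))) (inter_anti (suppAt_subset_supp hcl hb))
      h1 h3

/-- If `a ∈ X` is missing from `Y`, then `X \ {a}` is completed to the hull both by `a` and by `Y`,
so it already spans, against minimality. -/
theorem minimal_subset (hcl : boundary C ⊆ projImage C) {X Y : Set (RealProj n)}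
    (hX : Minimal (IsFiniteSpanning C) X) (hY : IsFiniteSpanning C Y) : X ⊆ Y := by
  intro a haX
  by_contra haY
  rw [isFiniteSpanning_iff hcl] at hY
  obtain ⟨hXC, hXf, hXs⟩ := (isFiniteSpanning_iff hcl).1 hX.1
  have hspan : IsFiniteSpanning C (X \ {a}) := by
    rw [isFiniteSpanning_iff hcl]
    refine ⟨Set.sdiff_subset.trans hXC, hXf.subset Set.sdiff_subset, ?_⟩
    refine inter_subset_of_notMem hcl (hXC haX) subset_rfl hY.2.1 hY.1 haY _
      (subset_inter_suppOn _) (fun x hx => hXs (mem_inter.2 fun H hH => ?_))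
      fun x hx => hY.2.2 hx.2
    obtain ⟨hHX, hHC⟩ := mem_suppOn.1 hH
    by_cases hHa : H.apex = a
    · exact mem_inter.1 hx.2 H ⟨hHa, hHC⟩
    · exact mem_inter.1 hx.1 H (mem_suppOn.2 ⟨⟨hHX, hHa⟩, hHC⟩)
  exact (hX.2 hspan Set.sdiff_subset haX).2 rfl

theorem existsUnique_minimal (hcl : boundary C ⊆ projImage C)
    (hfin : ∃ X, IsFiniteSpanning C X) :
    ∃! A : Set (RealProj n), Minimal (IsFiniteSpanning C) A := by
  obtain ⟨X, hX⟩ := hfin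
  have hf : {Y | Y ⊆ X ∧ IsFiniteSpanning C Y}.Finite :=
    hX.2.1.finite_subsets.subset fun Y hY => hY.1
  obtain ⟨A, hA⟩ := hf.exists_minimal ⟨X, subset_rfl, hX⟩
  have hmin : Minimal (IsFiniteSpanning C) A :=
    ⟨hA.1.2, fun Y hY hYA => hA.2 ⟨hYA.trans hA.1.1, hY⟩ hYA⟩
  exact ⟨A, hmin, fun B hB =>
    Set.Subset.antisymm (minimal_subset hcl hB hmin.1) (minimal_subset hcl hmin hB.1)⟩

theorem apices_eq_minimal (hcl : boundary C ⊆ projImage C) {A : Set (RealProj n)}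
    (hA : Minimal (IsFiniteSpanning C) A) {Γ : Set (HalfSpace n)}
    (hΓ : IsNonRedundantRep C Γ) : HalfSpace.apex '' Γ = A := by
  have hCΓ : C = inter Γ := hΓ.inter_eq
  refine Set.Subset.antisymm ?_ (minimal_subset hcl hA ((isFiniteSpanning_iff hcl).2 ⟨?_, ?_, ?_⟩))
  · rintro _ ⟨H, hH, rfl⟩
    by_contra hHA
    obtain ⟨hAC, hAf, hAs⟩ := (isFiniteSpanning_iff hcl).1 hA.1
    refine hΓ.nonredundant H hH (mem_tau.2 ⟨hΓ.subset hH, subset_trans ?_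
      (inter_subset (hΓ.subset hH))⟩)
    -- Only `H` is removed, not every half-space with its apex. Both `H` and the half-spaces with
    -- apices in `A` complete `Γ \ {H}`, so `H` would be redundant.
    refine inter_subset_of_notMem hcl (apex_mem_boundary (hΓ.subset hH)) (F := {H}) ?_ hAf hAC hHA
      _ (hCΓ.subset.trans (inter_anti Set.sdiff_subset)) ?_ fun x hx => hAs hx.2
    · rintro _ rfl
      exact ⟨rfl, (hΓ.subset hH).1⟩
    · rw [← inter_union, Set.sdiff_union_of_subset (Set.singleton_subset_iff.2 hH), ← hCΓ]
      exact subset_inter_supp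
  · rintro _ ⟨H, hH, rfl⟩
    exact apex_mem_boundary (hΓ.subset hH)
  · exact hΓ.finite.image _
  · refine subset_trans (inter_anti fun H hH => ?_) (hCΓ.symm.subset.trans subset_inter_supp)
    exact mem_suppOn.2 ⟨⟨H, hH, rfl⟩, (hΓ.subset hH).1⟩

end Closure

theorem exists_isFiniteSpanning {n p : ℕ} (v : Fin p → Fin n → ℝ) :
    ∃ X, IsFiniteSpanning (generatedCone v) X := by
  simp only [isFiniteSpanning_iff (boundary_subset v)]
  rcases isEmpty_or_nonempty (Fin p) with hp | hp
  · refine ⟨∅, Set.empty_subset _, Set.finite_empty, fun x _ => mem_inter.2 fun H hH => ?_⟩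
    obtain ⟨a, ha⟩ := H.apex.exists_rep
    obtain ⟨i, -⟩ := H.sect_nonempty
    obtain ⟨r, -⟩ := mk_mem_projImage.1 (ha ▸ hH.2) i
    exact hp.elim r
  · obtain ⟨X, hX, hXf, hXs⟩ := exists_finite_apices v
    exact ⟨X, hX, hXf, hXs.trans subset_inter_supp⟩

end TropicalCone

theorem mainTheorem3 (n : ℕ) (C : Set (Fin n → TropicalCone.MaxPlus))
    (hC : TropicalCone.IsRealPolyhedralCone C) :
    TropicalCone.IsClosureOperatorOn (TropicalCone.boundary C) (TropicalCone.tau' C) ∧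
    (∃! A : Set (TropicalCone.RealProj n), Minimal (TropicalCone.IsFiniteSpanning C) A) ∧
    ∀ A : Set (TropicalCone.RealProj n), Minimal (TropicalCone.IsFiniteSpanning C) A →
      ∀ Γ : Set (TropicalCone.HalfSpace n), TropicalCone.IsNonRedundantRep C Γ →
        TropicalCone.HalfSpace.apex '' Γ = A := by
  obtain ⟨p, v, rfl⟩ := hC
  have hcl := TropicalCone.boundary_subset v
  exact ⟨TropicalCone.isClosureOperatorOn_tau' hcl fun a ha => TropicalCone.suppAt_nonempty ha,
    TropicalCone.existsUnique_minimal hcl (TropicalCone.exists_isFiniteSpanning v),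
    fun A hA Γ hΓ => TropicalCone.apices_eq_minimal hcl hA hΓ⟩
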